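/- **Theorem 3.1.** For a field $K\subseteq\mathbb C$ and a binary form $f\in K[x,y]$ of degree $d$, the $K$-rank $L_K(f)$ is the smallest $r$ for which there are $\lambda_j,\alpha_j,\beta_j\in K$ $(1\le j\le r)$ with $$f(x,y)=\sum_{j=1}^r\lambda_j(\alpha_jx+\beta_jy)^d .$$ For every $d\ge5$ there is a binary form $p\in\mathbb C[x,y]$ of degree $d$ that has at least three different relative ranks; that is, the set of the values $L_K(p)$, where $K$ runs over the subfields of $\mathbb C$ that contain the coefficients of $p$, has at least three elements. Explicitly, let $k\ge3$, and for $m\geq 1$ let $\zeta_m\in\mathbb C$ denote a primitive $m$-th root of unity. The form $p_{2k-1}=x^{k-1}y^{k-1}(x-y)$, of degree $2k-1$, satisfies $$L_{\mathbb Q(\zeta_{k+1})}(p_{2k-1})=k,\qquad L_{\mathbb Q(\zeta_k)}(p_{2k-1})=k+1,\qquad L_{\mathbb R}(p_{2k-1})=2k-1,$$ and the form $p_{2k}=x^ky^k$, of degree $2k$, satisfies $$L_{\mathbb Q(\zeta_{k+1})}(p_{2k})=k+1,\qquad L_{\mathbb Q(\zeta_k)}(p_{2k})=k+2,\qquad L_{\mathbb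 R}(p_{2k})=2k .$$ -/

import Mathlib

open MvPolynomial
open scoped IntermediateField

/-- The form `f` of degree `d` (in the variables `x = X 0`, `y = X 1`) is a `K`-linear combination
of the `d`-th powers of `r` linear forms with coefficients in the field `K ⊆ ℂ`. -/
def HasPowerRep (K : Subfield ℂ) (d : ℕ) (f : MvPolynomial (Fin 2) ℂ) (r : ℕ) : Prop :=
  ∃ lam a b : Fin r → K,
    f = ∑ j, C (lam j : ℂ) * (C (a j : ℂ) * X 0 + C (b j : ℂ) * X 1) ^ d

/-- `r` is the `K`-rank (`K`-length) `L_K(f)` of the form `f` of degree `d`: it is the smallest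
number of summands in a representation of `f` as a `K`-linear combination of `d`-th powers of
linear forms over `K` (in particular such a representation exists). -/
def IsRelRank (K : Subfield ℂ) (d : ℕ) (f : MvPolynomial (Fin 2) ℂ) (r : ℕ) : Prop :=
  IsLeast {s : ℕ | HasPowerRep K d f s} r

/-- The set of all relative ranks of the form `f` of degree `d`, taken over all the fields
`K ⊆ ℂ` that contain the coefficients of `f`. -/
def relRanks (d : ℕ) (f : MvPolynomial (Fin 2) ℂ) : Set ℕ :=
  {r | ∃ K : Subfield ℂ, (∀ m, f.coeff m ∈ K) ∧ IsRelRank K d f r}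

/-- The field of real numbers as a subfield of `ℂ`. -/
noncomputable def realSubfield : Subfield ℂ := Complex.ofRealHom.fieldRange

/-- The form `x^(k-1) y^(k-1) (x - y)`, of degree `2k - 1` for `k ≥ 1`. -/
noncomputable def oddForm (k : ℕ) : MvPolynomial (Fin 2) ℂ :=
  X 0 ^ (k - 1) * X 1 ^ (k - 1) * (X 0 - X 1)

/-- The form `x^k y^k`, of degree `2k`. -/
noncomputable def evenForm (k : ℕ) : MvPolynomial (Fin 2) ℂ :=
  X 0 ^ k * X 1 ^ k

/-!
By Sylvester's apolarity theorem, representing a form of degree `d` as a `K`-combination of `d`-th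
powers of linear forms amounts to finding a form, a product of distinct linear factors over `K`,
that annihilates it as a differential operator. A form `P` of degree `n` is apolar to `x ^ k y ^ k`
if and only if the coefficients of `X ^ m` in `P` vanish for `n - k ≤ m ≤ k`, and it is apolar to
`x ^ (k - 1) y ^ (k - 1) (x - y)` if and only if `(X - 1) P` is apolar to `x ^ k y ^ k`. Both forms
are therefore governed by split polynomials with a gap in the middle. If the degree is `k + 1`, the
gap leaves only a binomial, whose splitting forces `K` to contain the `(k + 1)`-st roots of unity.
Over `ℝ`, two consecutive vanishing coefficients are impossible unless `0` is a multiple root, which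
forces `n ≥ 2 k`. These bounds are attained by `X ^ (k + 1) - 1`, by `X (X ^ k - 1)` with an
additional root at infinity, and by a polynomial of degree `2 k` with distinct rational roots and no
term in `X ^ k`; all of these have the root `1`, as the odd case requires.
-/

open scoped Polynomial

section MomentForm

variable {R : Type*} [CommRing R]

/-- The binary form `∑ i, (d choose i) aᵢ x^(d-i) y^i` with normalized coefficients `aᵢ`, as a
linear function of the sequence `a`; only the values `aᵢ` with `i ≤ d` matter. -/
noncomputable def momentForm (d : ℕ) : (ℕ → R) →ₗ[R] MvPolynomial (Fin 2) R :=
  ∑ i ∈ Finset.range (d + 1),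
    (LinearMap.proj i).smulRight (C (d.choose i : R) * (X 0 ^ (d - i) * X 1 ^ i))

theorem momentForm_apply (d : ℕ) (a : ℕ → R) :
    momentForm d a =
      ∑ i ∈ Finset.range (d + 1), C (a i * d.choose i) * (X 0 ^ (d - i) * X 1 ^ i) := by
  simp [momentForm, MvPolynomial.smul_eq_C_mul, mul_assoc]

theorem momentForm_congr {d : ℕ} {a b : ℕ → R} (h : ∀ i ≤ d, a i = b i) :
    momentForm d a = momentForm d b := by
  simp only [momentForm_apply]
  exact Finset.sum_congr rfl fun i hi => by rw [h i (Finset.mem_range_succ_iff.1 hi)]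

theorem momentForm_single {d i : ℕ} (hi : i ≤ d) (c : R) :
    momentForm d (Pi.single i c) = C (c * d.choose i) * (X 0 ^ (d - i) * X 1 ^ i) := by
  rw [momentForm_apply, Finset.sum_eq_single_of_mem i (Finset.mem_range_succ_iff.2 hi)]
  · simp
  · intro j _ hj
    simp [hj]

theorem momentForm_geometric (d : ℕ) (c a b : R) :
    momentForm d (fun i => c * (a ^ (d - i) * b ^ i)) = C c * (C a * X 0 + C b * X 1) ^ d := by
  rw [momentForm_apply, add_comm (C a * X 0), add_pow, Finset.mul_sum]
  refine Finset.sum_congr rfl fun i _ => ?_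
  simp only [map_mul, map_pow, map_natCast]
  ring

theorem momentForm_eq_momentForm_iff [IsDomain R] [CharZero R] {d : ℕ} {a b : ℕ → R} :
    momentForm d a = momentForm d b ↔ ∀ i ≤ d, a i = b i := by
  refine ⟨fun h i hi => ?_, momentForm_congr⟩
  have coeff_dehomogenize (c : ℕ → R) :
      (aeval ![(1 : R[X]), Polynomial.X] (momentForm d c)).coeff i = c i * d.choose i := by
    simp only [momentForm_apply, map_sum, map_mul, map_pow, aeval_X, aeval_C,
      Polynomial.finsetSum_coeff]
    simp [mul_assoc, Polynomial.coeff_X_pow, hi.not_gt]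
  have hchoose : (d.choose i : R) ≠ 0 := Nat.cast_ne_zero.2 (Nat.choose_pos hi).ne'
  exact mul_right_cancel₀ hchoose (by rw [← coeff_dehomogenize a, h, coeff_dehomogenize b])

end MomentForm

section PowerRep

variable {K : Subfield ℂ} {d r s : ℕ} {f : MvPolynomial (Fin 2) ℂ}

theorem HasPowerRep.add_pow (h : HasPowerRep K d f r) (c a b : K) :
    HasPowerRep K d (f + C (c : ℂ) * (C (a : ℂ) * X 0 + C (b : ℂ) * X 1) ^ d) (r + 1) := by
  obtain ⟨lam, A, B, rfl⟩ := h
  refine ⟨Fin.cons c lam, Fin.cons a A, Fin.cons b B, ?_⟩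
  rw [Fin.sum_univ_succ, add_comm]
  simp

theorem HasPowerRep.mono (h : HasPowerRep K d f r) (hrs : r ≤ s) : HasPowerRep K d f s := by
  induction s, hrs using Nat.le_induction with
  | base => exact h
  | succ s _ ih => simpa using ih.add_pow 0 0 0

theorem hasPowerRep_sum {ι : Type*} (T : Finset ι) (c a b : ι → K) :
    HasPowerRep K d (∑ t ∈ T, C (c t : ℂ) * (C (a t : ℂ) * X 0 + C (b t : ℂ) * X 1) ^ d)
      T.card := by
  classical
  induction T using Finset.induction_on with
  | empty =>
    rw [Finset.card_empty]
    exact ⟨0, 0, 0, by simp⟩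
  | insert t T ht ih =>
    rw [Finset.sum_insert ht, add_comm, Finset.card_insert_of_notMem ht]
    exact ih.add_pow _ _ _

theorem HasPowerRep.isHomogeneous (h : HasPowerRep K d f r) : f.IsHomogeneous d := by
  obtain ⟨lam, a, b, rfl⟩ := h
  refine IsHomogeneous.sum _ _ _ fun j _ => ?_
  have hlinear : (C (a j : ℂ) * X 0 + C (b j : ℂ) * X (1 : Fin 2)).IsHomogeneous 1 :=
    (isHomogeneous_C_mul_X _ _).add (isHomogeneous_C_mul_X _ _)
  simpa using (hlinear.pow d).C_mul (lam j : ℂ)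

theorem HasPowerRep.coeff_mem (h : HasPowerRep K d f r) (m : Fin 2 →₀ ℕ) : f.coeff m ∈ K := by
  obtain ⟨lam, a, b, rfl⟩ := h
  have hmap : MvPolynomial.map K.subtype
      (∑ j, C (lam j) * (C (a j) * X (0 : Fin 2) + C (b j) * X 1) ^ d) =
      ∑ j, C (lam j : ℂ) * (C (a j : ℂ) * X 0 + C (b j : ℂ) * X 1) ^ d := by
    simp
  rw [← hmap, coeff_map]
  exact SetLike.coe_mem _

theorem three_le_encard_relRanks {K₁ K₂ K₃ : Subfield ℂ} {r₁ r₂ r₃ : ℕ}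
    (h₁ : IsRelRank K₁ d f r₁) (h₂ : IsRelRank K₂ d f r₂) (h₃ : IsRelRank K₃ d f r₃)
    (h₁₂ : r₁ < r₂) (h₂₃ : r₂ < r₃) : 3 ≤ (relRanks d f).encard := by
  rw [← Set.encard_eq_three.2 ⟨r₁, r₂, r₃, h₁₂.ne, (h₁₂.trans h₂₃).ne, h₂₃.ne, rfl⟩]
  refine Set.encard_le_encard ?_
  rintro r (rfl | rfl | rfl)
  exacts [⟨K₁, h₁.1.coeff_mem, h₁⟩, ⟨K₂, h₂.1.coeff_mem, h₂⟩, ⟨K₃, h₃.1.coeff_mem, h₃⟩]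

end PowerRep

section Apolarity

variable {R : Type*} [CommRing R]

/-- The linear functional on polynomials with moments `a`, that is, `X ^ i ↦ a i`. It pairs a
polynomial, regarded as a binary differential operator of degree `d`, with `momentForm d a`. -/
noncomputable def momentFunctional : (ℕ → R) ≃ₗ[R] (R[X] →ₗ[R] R) :=
  (Polynomial.basisMonomials R).constr R

theorem momentFunctional_X_pow (a : ℕ → R) (i : ℕ) :
    momentFunctional a (Polynomial.X ^ i) = a i := by
  simpa [momentFunctional, Polynomial.X_pow_eq_monomial] using
    (Polynomial.basisMonomials R).constr_basis R a i

theorem momentFunctional_apply (a : ℕ → R) {p : R[X]} {n : ℕ} (hp : p.natDegree < n) :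
    momentFunctional a p = ∑ i ∈ Finset.range n, p.coeff i * a i := by
  conv_lhs => rw [p.as_sum_range_C_mul_X_pow' hp]
  simp [← Polynomial.smul_eq_C_mul, momentFunctional_X_pow]

theorem momentFunctional_single (k : ℕ) (c : R) (p : R[X]) :
    momentFunctional (Pi.single k c) p = p.coeff k * c := by
  rw [momentFunctional_apply _ (Nat.lt_succ_of_le (le_max_left p.natDegree k)),
    Finset.sum_eq_single_of_mem k (Finset.mem_range_succ_iff.2 (le_max_right _ _))]
  · simp
  · intro i _ hi
    simp [hi]

/-- The polynomial `g`, dehomogenizing a binary form of degree `n`, is apolar to the binary form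
of degree `d` with normalized coefficients `a`: that form is annihilated by the differential
operator given by the form of degree `n`. -/
def IsApolar (d n : ℕ) (a : ℕ → R) (g : R[X]) : Prop :=
  ∀ l, l + n ≤ d → momentFunctional a (Polynomial.X ^ l * g) = 0

variable {d n : ℕ} {a : ℕ → R} {T : Finset R}

theorem IsApolar.momentFunctional_mul_eq_zero {g : R[X]} (h : IsApolar d n a g) {q : R[X]}
    (hq : q.natDegree + n ≤ d) : momentFunctional a (q * g) = 0 := by
  rw [q.as_sum_range_C_mul_X_pow, Finset.sum_mul, map_sum]
  refine Finset.sum_eq_zero fun l hl => ?_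
  have hl' := Finset.mem_range_succ_iff.1 hl
  rw [mul_assoc, ← Polynomial.smul_eq_C_mul, map_smul, h l (by omega), smul_zero]

theorem momentFunctional_eq_sum_weights {N : ℕ} {w : R → R}
    (h : ∀ i < N, a i = ∑ t ∈ T, w t * t ^ i) {p : R[X]} (hp : p.natDegree < N) :
    momentFunctional a p = ∑ t ∈ T, w t * p.eval t := by
  simp only [momentFunctional_apply a hp, Polynomial.eval_eq_sum_range' hp, Finset.mul_sum]
  rw [Finset.sum_comm]
  refine Finset.sum_congr rfl fun i hi => ?_
  rw [h i (Finset.mem_range.1 hi), Finset.mul_sum]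
  exact Finset.sum_congr rfl fun t _ => mul_left_comm _ _ _

theorem isApolar_nodal_of_weights {w : R → R}
    (hw : ∀ i, i + n ≤ d + T.card → a i = ∑ t ∈ T, w t * t ^ i) :
    IsApolar d n a (Lagrange.nodal T id) := by
  intro l hl
  obtain _ | _ := subsingleton_or_nontrivial R
  · exact Subsingleton.elim _ _
  have hdeg : (Polynomial.X ^ l * Lagrange.nodal T id).natDegree < d + T.card + 1 - n := by
    refine Polynomial.natDegree_mul_le.trans_lt ?_
    rw [Polynomial.natDegree_X_pow, Lagrange.natDegree_nodal]
    omega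
  rw [momentFunctional_eq_sum_weights (fun i hi => hw i (by omega)) hdeg]
  refine Finset.sum_eq_zero fun t ht => ?_
  have hroot : (Lagrange.nodal T id).eval t = 0 := Lagrange.eval_nodal_at_node (v := id) ht
  simp [hroot]

variable {F : Type*} [Field F]

theorem momentFunctional_eq_sum_basis [DecidableEq F] {T : Finset F} (a : ℕ → F) {p : F[X]}
    (hp : p.degree < T.card) :
    momentFunctional a p = ∑ t ∈ T, momentFunctional a (Lagrange.basis T id t) * p.eval t := by
  conv_lhs => rw [Lagrange.eq_interpolate (s := T) Function.injective_id.injOn hp]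
  rw [Lagrange.interpolate_apply, map_sum]
  refine Finset.sum_congr rfl fun t _ => ?_
  rw [← Polynomial.smul_eq_C_mul, map_smul, smul_eq_mul, mul_comm, id]

/-- Modulo `∏ (X - t)` every polynomial is determined by its values on `T`, and an apolar
functional does not see the multiples of `∏ (X - t)`. -/
theorem IsApolar.exists_weights {a : ℕ → F} {T : Finset F}
    (h : IsApolar d n a (Lagrange.nodal T id)) :
    ∃ w : F → F, ∀ i, i + n ≤ d + T.card → a i = ∑ t ∈ T, w t * t ^ i := by
  classical
  set g := Lagrange.nodal T id with hg
  have g_monic : g.Monic := Lagrange.nodal_monic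
  refine ⟨fun t => momentFunctional a (Lagrange.basis T id t), fun i hi => ?_⟩
  have hdeg : (Polynomial.X ^ i %ₘ g).degree < T.card := by
    simpa [hg] using Polynomial.degree_modByMonic_lt (Polynomial.X ^ i) g_monic
  have hquot : momentFunctional a (Polynomial.X ^ i /ₘ g * g) = 0 := by
    obtain hiT | hiT := le_or_gt T.card i
    · refine h.momentFunctional_mul_eq_zero ?_
      rw [Polynomial.natDegree_divByMonic _ g_monic, Polynomial.natDegree_X_pow,
        hg, Lagrange.natDegree_nodal]
      omega
    · rw [(Polynomial.divByMonic_eq_zero_iff g_monic).2, zero_mul, map_zero]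
      simpa [hg] using hiT
  rw [← momentFunctional_X_pow a, ← Polynomial.modByMonic_add_div (Polynomial.X ^ i) g, map_add,
    mul_comm g, hquot, add_zero, momentFunctional_eq_sum_basis a hdeg]
  refine Finset.sum_congr rfl fun t ht => ?_
  have hroot : g.eval t = 0 := Lagrange.eval_nodal_at_node (v := id) ht
  rw [Polynomial.modByMonic_eq_sub_mul_div]
  simp [hroot]

end Apolarity

section Sylvester

/-- Linear forms `A x + B y` with the same slope `B / A` are merged, and all those with `A = 0`
contribute only to the last moment, which costs one extra node. -/
theorem exists_nodes_of_powers {F ι : Type*} [Field F] [Fintype ι] (d : ℕ) (lam A B : ι → F) :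
    ∃ (T : Finset F) (n : ℕ) (w : F → F), T.card ≤ n ∧ n ≤ T.card + 1 ∧ n ≤ Fintype.card ι ∧
      ∀ i, i + n ≤ d + T.card → ∑ j, lam j * (A j ^ (d - i) * B j ^ i) = ∑ t ∈ T, w t * t ^ i := by
  classical
  set J : Finset ι := {j | A j ≠ 0} with hJ
  set T := J.image fun j => B j / A j
  let w : F → F := fun t => ∑ j ∈ J with B j / A j = t, lam j * A j ^ d
  have sum_J {i : ℕ} (hi : i ≤ d) :
      ∑ j ∈ J, lam j * (A j ^ (d - i) * B j ^ i) = ∑ t ∈ T, w t * t ^ i := by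
    rw [← Finset.sum_fiberwise_of_maps_to (t := T)
      fun j hj => Finset.mem_image_of_mem (fun j => B j / A j) hj]
    refine Finset.sum_congr rfl fun t _ => ?_
    rw [Finset.sum_mul]
    refine Finset.sum_congr rfl fun j hj => ?_
    obtain ⟨hjJ, rfl⟩ := Finset.mem_filter.1 hj
    have hAj : A j ≠ 0 := (Finset.mem_filter.1 hjJ).2
    rw [div_pow, ← pow_sub_mul_pow (A j) hi]
    field_simp
  by_cases hJuniv : J = Finset.univ
  · refine ⟨T, T.card, w, le_rfl, Nat.le_succ _, ?_, fun i hi => ?_⟩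
    · exact Finset.card_image_le.trans (Finset.card_le_univ _)
    · rw [← sum_J (by omega), hJuniv]
  · refine ⟨T, T.card + 1, w, Nat.le_succ _, le_rfl, ?_, fun i hi => ?_⟩
    · exact Finset.card_image_le.trans_lt ((Finset.card_lt_iff_ne_univ J).2 hJuniv)
    · rw [← sum_J (by omega)]
      refine (Finset.sum_subset (Finset.subset_univ J) fun j _ hj => ?_).symm
      have hAj : A j = 0 := by simpa [hJ] using hj
      rw [hAj, zero_pow (by omega), zero_mul, mul_zero]

variable {K : Subfield ℂ} {d r : ℕ}

theorem hasPowerRep_momentForm_sum (T : Finset K) (w : K → K) :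
    HasPowerRep K d (momentForm d fun i => ((∑ t ∈ T, w t * t ^ i : K) : ℂ)) T.card := by
  convert hasPowerRep_sum T w 1 id using 1
  simp_rw [← momentForm_geometric, ← map_sum]
  refine momentForm_congr fun i _ => ?_
  simp

/-- Sylvester's theorem: `T` collects the nodes of a representation other than `∞`, and `n` counts
`∞` as well if it is used. -/
theorem hasPowerRep_momentForm_iff {a : ℕ → K} :
    HasPowerRep K d (momentForm d fun i => (a i : ℂ)) r ↔
      ∃ (T : Finset K) (n : ℕ), T.card ≤ n ∧ n ≤ T.card + 1 ∧ n ≤ r ∧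
        IsApolar d n a (Lagrange.nodal T id) := by
  constructor
  · rintro ⟨lam, A, B, hf⟩
    obtain ⟨T, n, w, hTn, hnT, hnr, hw⟩ := exists_nodes_of_powers d lam A B
    rw [Fintype.card_fin] at hnr
    refine ⟨T, n, hTn, hnT, hnr, isApolar_nodal_of_weights (w := w) fun i hi => ?_⟩
    simp_rw [← momentForm_geometric, ← map_sum] at hf
    rw [← hw i hi]
    exact_mod_cast (momentForm_eq_momentForm_iff.1 hf i (by omega)).trans
      (Finset.sum_apply i Finset.univ _)
  · rintro ⟨T, n, hTn, hnT, hnr, hapolar⟩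
    obtain ⟨w, hw⟩ := hapolar.exists_weights
    refine HasPowerRep.mono ?_ hnr
    obtain rfl | rfl : n = T.card ∨ n = T.card + 1 := by omega
    · rw [momentForm_congr fun i hi => congrArg Subtype.val (hw i (by omega))]
      exact hasPowerRep_momentForm_sum T w
    · set c : K := a d - ∑ t ∈ T, w t * t ^ d
      convert (hasPowerRep_momentForm_sum T w).add_pow c 0 1 using 1
      rw [← momentForm_geometric, ← map_add]
      refine momentForm_congr fun i hi => ?_
      obtain rfl | hid := hi.eq_or_lt
      · simp [c]
      · simp [hw i (by omega), (Nat.sub_pos_of_lt hid).ne']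

end Sylvester

section CentralGap

variable {R : Type*} [CommRing R] {k n : ℕ} {P : R[X]}

/-- The coefficients of `X ^ m` in `P` vanish for `n - k ≤ m ≤ k`. This says that `P`, regarded as
the dehomogenization of a form of degree `n`, is apolar to `x ^ k y ^ k`. -/
def HasCentralGap (k n : ℕ) (P : R[X]) : Prop :=
  ∀ m ≤ k, n ≤ k + m → P.coeff m = 0

theorem hasCentralGap_iff_coeff_X_pow_mul :
    HasCentralGap k n P ↔ ∀ l, l + n ≤ 2 * k → (Polynomial.X ^ l * P).coeff k = 0 := by
  simp only [Polynomial.coeff_X_pow_mul']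
  constructor
  · intro h l hl
    split_ifs
    · exact h _ (Nat.sub_le _ _) (by omega)
    · rfl
  · intro h m hm hn
    simpa [Nat.sub_sub_self hm] using h (k - m) (by omega)

theorem isApolar_single_iff [NoZeroDivisors R] {c : R} (hc : c ≠ 0) :
    IsApolar (2 * k) n (Pi.single k c) P ↔ HasCentralGap k n P := by
  simp only [IsApolar, momentFunctional_single, mul_eq_zero, hc, or_false,
    hasCentralGap_iff_coeff_X_pow_mul]

theorem isApolar_single_sub_single_iff [NoZeroDivisors R] (hk : 1 ≤ k) {c : R}
    (hc : c ≠ 0) :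
    IsApolar (2 * k - 1) n (Pi.single (k - 1) c - Pi.single k c) P ↔
      HasCentralGap k (n + 1) ((Polynomial.X - Polynomial.C 1) * P) := by
  obtain ⟨k, rfl⟩ := Nat.exists_eq_add_of_le' hk
  have coeff_mul (l : ℕ) :
      (Polynomial.X ^ l * ((Polynomial.X - Polynomial.C 1) * P)).coeff (k + 1) =
        (Polynomial.X ^ l * P).coeff k - (Polynomial.X ^ l * P).coeff (k + 1) := by
    rw [mul_left_comm, sub_mul, Polynomial.coeff_sub, Polynomial.coeff_X_mul, Polynomial.C_1,
      one_mul]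
  simp only [IsApolar, map_sub, LinearMap.sub_apply, momentFunctional_single, ← sub_mul,
    mul_eq_zero, hc, or_false, hasCentralGap_iff_coeff_X_pow_mul, coeff_mul, Nat.add_sub_cancel]
  exact forall_congr' fun l => imp_congr_left (by omega)

variable {K : Subfield ℂ} {r : ℕ}

theorem evenForm_eq_momentForm (k : ℕ) :
    evenForm k = momentForm (2 * k) (Pi.single k ((2 * k).choose k : ℂ)⁻¹) := by
  have hchoose : ((2 * k).choose k : ℂ) ≠ 0 := Nat.cast_ne_zero.2 (Nat.choose_pos (by omega)).ne'
  rw [momentForm_single (by omega), inv_mul_cancel₀ hchoose, evenForm, C_1, one_mul,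
    show 2 * k - k = k by omega]

theorem oddForm_eq_momentForm (hk : 1 ≤ k) :
    oddForm k = momentForm (2 * k - 1)
      (Pi.single (k - 1) ((2 * k - 1).choose k : ℂ)⁻¹ -
        Pi.single k ((2 * k - 1).choose k : ℂ)⁻¹) := by
  have hchoose : ((2 * k - 1).choose k : ℂ) ≠ 0 :=
    Nat.cast_ne_zero.2 (Nat.choose_pos (by omega)).ne'
  have hsymm : (2 * k - 1).choose (k - 1) = (2 * k - 1).choose k :=
    Nat.choose_symm_of_eq_add (by omega)
  rw [map_sub, momentForm_single (by omega), momentForm_single (by omega), hsymm,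
    inv_mul_cancel₀ hchoose, oddForm, C_1, show 2 * k - 1 - (k - 1) = k by omega,
    show 2 * k - 1 - k = k - 1 by omega, ← pow_sub_one_mul (by omega : k ≠ 0) (X 0),
    ← pow_sub_one_mul (by omega : k ≠ 0) (X 1)]
  ring

theorem coe_pi_single (k : ℕ) (c : K) (i : ℕ) :
    ((Pi.single k c : ℕ → K) i : ℂ) = (Pi.single k (c : ℂ) : ℕ → ℂ) i :=
  Pi.apply_single (fun _ => K.subtype) (fun _ => map_zero _) k c i

theorem hasPowerRep_evenForm_iff :
    HasPowerRep K (2 * k) (evenForm k) r ↔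
      ∃ (T : Finset K) (n : ℕ), T.card ≤ n ∧ n ≤ T.card + 1 ∧ n ≤ r ∧
        HasCentralGap k n (Lagrange.nodal T id) := by
  have hchoose : ((2 * k).choose k : K)⁻¹ ≠ 0 :=
    inv_ne_zero (Nat.cast_ne_zero.2 (Nat.choose_pos (by omega)).ne')
  simp_rw [← isApolar_single_iff hchoose, ← hasPowerRep_momentForm_iff, evenForm_eq_momentForm]
  congr! 3 with i
  simp [coe_pi_single]

theorem hasPowerRep_oddForm_iff (hk : 1 ≤ k) :
    HasPowerRep K (2 * k - 1) (oddForm k) r ↔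
      ∃ (T : Finset K) (n : ℕ), T.card ≤ n ∧ n ≤ T.card + 1 ∧ n ≤ r ∧
        HasCentralGap k (n + 1)
          ((Polynomial.X - Polynomial.C 1) * Lagrange.nodal T id) := by
  have hchoose : ((2 * k - 1).choose k : K)⁻¹ ≠ 0 :=
    inv_ne_zero (Nat.cast_ne_zero.2 (Nat.choose_pos (by omega)).ne')
  simp_rw [← isApolar_single_sub_single_iff hk hchoose, ← hasPowerRep_momentForm_iff,
    oddForm_eq_momentForm hk]
  congr! 3 with i
  simp [coe_pi_single]

end CentralGap

section RealRooted

/-- For `p = ∏ (X - rᵢ)` with nonzero `rᵢ`, the difference of the two sides is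
`p(0) ^ 2 * ∑ rᵢ⁻¹ ^ 2`. -/
theorem two_mul_coeff_zero_mul_coeff_two_le {R : Type*} [CommRing R] [LinearOrder R]
    [IsStrictOrderedRing R] {p : R[X]} (hp : p.Splits) :
    2 * p.coeff 0 * p.coeff 2 ≤ p.coeff 1 ^ 2 := by
  induction hp using Submonoid.closure_induction with
  | mem p hp => obtain ⟨a, rfl⟩ | ⟨a, rfl⟩ := hp <;> simp [Polynomial.coeff_X, Polynomial.coeff_C]
  | one => simp [Polynomial.coeff_one]
  | mul p q _ _ hp hq =>
    have coeff_two : (p * q).coeff 2 =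
        p.coeff 0 * q.coeff 2 + p.coeff 1 * q.coeff 1 + p.coeff 2 * q.coeff 0 := by
      simp [Polynomial.coeff_mul, Finset.Nat.antidiagonal_succ, add_assoc]
    rw [Polynomial.mul_coeff_zero, Polynomial.mul_coeff_one, coeff_two]
    linear_combination p.coeff 0 ^ 2 * hq + q.coeff 0 ^ 2 * hp

theorem coeff_zero_eq_zero_of_splits {F : Type*} [Field F] [LinearOrder F]
    [IsStrictOrderedRing F] {p : F[X]} (hp : p.Splits) (hdeg : 0 < p.natDegree)
    (h₁ : p.coeff 1 = 0) (h₂ : p.coeff 2 = 0) : p.coeff 0 = 0 := by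
  obtain ⟨r, hr⟩ := hp.exists_eval_eq_zero (Polynomial.natDegree_pos_iff_degree_pos.1 hdeg).ne'
  obtain ⟨q, rfl⟩ := Polynomial.dvd_iff_isRoot.2 hr
  have hq := two_mul_coeff_zero_mul_coeff_two_le (Polynomial.splits_X_sub_C_mul_iff.1 hp)
  simp only [sub_mul, Polynomial.coeff_sub, Polynomial.coeff_C_mul, Polynomial.coeff_X_mul,
    Polynomial.coeff_X_mul_zero] at h₁ h₂ ⊢
  have hq₀ : q.coeff 0 ^ 2 ≤ 0 := by
    linear_combination (q.coeff 0 - r * q.coeff 1) * h₁ + 2 * r * q.coeff 0 * h₂ + r ^ 2 * hq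
  simp [pow_eq_zero_iff two_ne_zero |>.1 (le_antisymm hq₀ (sq_nonneg _))]

theorem splits_derivative {p : ℝ[X]} (hp : p.Splits) : (Polynomial.derivative p).Splits := by
  rw [Polynomial.splits_iff_card_roots] at hp ⊢
  refine (Polynomial.card_roots' _).antisymm ?_
  have := Polynomial.card_roots_le_derivative p
  have := Polynomial.natDegree_derivative_le p
  omega

theorem X_pow_dvd_of_consecutive_coeff_eq_zero {p : ℝ[X]} (hp : p.Splits) {j : ℕ}
    (hj : j < p.natDegree) (h₀ : p.coeff j = 0) (h₁ : p.coeff (j + 1) = 0) :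
    Polynomial.X ^ (j + 2) ∣ p := by
  induction j generalizing p with
  | zero =>
    rw [Polynomial.X_pow_dvd_iff]
    intro i hi
    interval_cases i <;> assumption
  | succ j ih =>
    have natDegree_derivative : (Polynomial.derivative p).natDegree = p.natDegree - 1 :=
      Polynomial.natDegree_derivative _
    have hdvd : Polynomial.X ^ (j + 2) ∣ Polynomial.derivative p :=
      ih (splits_derivative hp) (by omega) (by simp [Polynomial.coeff_derivative, h₀])
        (by simp [Polynomial.coeff_derivative, h₁])
    have coeff_succ {i : ℕ} (hi : i < j + 2) : p.coeff (i + 1) = 0 := by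
      have := Polynomial.X_pow_dvd_iff.1 hdvd i hi
      rw [Polynomial.coeff_derivative] at this
      exact (mul_eq_zero.1 this).resolve_right (by positivity)
    rw [Polynomial.X_pow_dvd_iff]
    rintro (_ | i) hi
    · exact coeff_zero_eq_zero_of_splits hp (by omega) (coeff_succ (by omega))
        (coeff_succ (by omega))
    · exact coeff_succ (by omega)

end RealRooted

section LowerBounds

variable {F : Type*} [Field F] {k n : ℕ} {P : F[X]}

/-- `P` dehomogenizes a binary form of degree `n` that is apolar to `x ^ k y ^ k` and splits into
linear factors over `F`, with `0` and `∞` at most simple zeros. Sylvester's theorem produces such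
polynomials from representations of both `x ^ k y ^ k` and `x ^ (k - 1) y ^ (k - 1) (x - y)`. -/
structure IsSylvesterPolynomial (k n : ℕ) (P : F[X]) : Prop where
  splits : P.Splits
  not_X_sq_dvd : ¬ Polynomial.X ^ 2 ∣ P
  natDegree_le : P.natDegree ≤ n
  le_natDegree_add_one : n ≤ P.natDegree + 1
  hasCentralGap : HasCentralGap k n P

namespace IsSylvesterPolynomial

theorem ne_zero (h : IsSylvesterPolynomial k n P) : P ≠ 0 := by
  rintro rfl
  exact h.not_X_sq_dvd (dvd_zero _)

theorem map {E : Type*} [Field E] (h : IsSylvesterPolynomial k n P) (φ : F →+* E) :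
    IsSylvesterPolynomial k n (P.map φ) where
  splits := h.splits.map φ
  not_X_sq_dvd := by
    simpa [Polynomial.X_pow_dvd_iff] using h.not_X_sq_dvd
  natDegree_le := by simpa using h.natDegree_le
  le_natDegree_add_one := by simpa using h.le_natDegree_add_one
  hasCentralGap m hm hn := by simp [h.hasCentralGap m hm hn]

theorem succ_le (h : IsSylvesterPolynomial k n P) : k + 1 ≤ n := by
  by_contra! hn
  refine h.ne_zero (Polynomial.ext fun m => ?_)
  obtain hm | hm := le_or_gt m k
  · exact h.hasCentralGap m hm (by omega)
  · exact Polynomial.coeff_eq_zero_of_natDegree_lt (by have := h.natDegree_le; omega)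

theorem natDegree_eq (h : IsSylvesterPolynomial k (k + 1) P) (hk : 1 ≤ k) :
    P.natDegree = k + 1 := by
  refine h.natDegree_le.antisymm (not_lt.1 fun hlt => h.ne_zero ?_)
  rw [← Polynomial.leadingCoeff_eq_zero]
  exact h.hasCentralGap _ (by omega) (by have := h.le_natDegree_add_one; omega)

theorem eq_binomial (h : IsSylvesterPolynomial k (k + 1) P) :
    P = Polynomial.C (P.coeff (k + 1)) * Polynomial.X ^ (k + 1) + Polynomial.C (P.coeff 0) := by
  ext m
  obtain rfl | hm₀ := Nat.eq_zero_or_pos m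
  · simp
  obtain rfl | hm := eq_or_ne m (k + 1)
  · simp
  · simp only [Polynomial.coeff_add, Polynomial.coeff_C_mul_X_pow, if_neg hm, Polynomial.coeff_C,
      if_neg hm₀.ne', add_zero]
    obtain hmk | hmk := le_or_gt m k
    · exact h.hasCentralGap m hmk (by omega)
    · exact Polynomial.coeff_eq_zero_of_natDegree_lt (by have := h.natDegree_le; omega)

/-- The quotients of the roots of `a X ^ (k + 1) + b` are the `(k + 1)`-st roots of unity. -/
theorem mem_fieldRange {E : Type*} [Field E] (h : IsSylvesterPolynomial k (k + 1) P)
    (hk : 1 ≤ k) (φ : F →+* E) {ζ : E} (hζ : ζ ^ (k + 1) = 1) : ζ ∈ φ.fieldRange := by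
  have hdeg : P.degree ≠ 0 := by
    rw [Polynomial.degree_eq_natDegree h.ne_zero, h.natDegree_eq hk]
    exact_mod_cast k.succ_ne_zero
  obtain ⟨t, ht⟩ := h.splits.exists_eval_eq_zero hdeg
  have eval_eq (x : F) : P.eval x = P.coeff (k + 1) * x ^ (k + 1) + P.coeff 0 := by
    conv_lhs => rw [h.eq_binomial]
    simp
  have ht₀ : t ≠ 0 := by
    rintro rfl
    refine h.not_X_sq_dvd ((pow_dvd_pow _ (by omega : 2 ≤ k + 1)).trans
      ⟨Polynomial.C (P.coeff (k + 1)), ?_⟩)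
    have hcoeff : P.coeff 0 = 0 := by simpa [eval_eq] using ht
    conv_lhs => rw [h.eq_binomial, hcoeff, Polynomial.C_0, add_zero, mul_comm]
  have hroot : (P.map φ).IsRoot (ζ * φ t) := by
    rw [Polynomial.IsRoot, (h.map φ).eq_binomial]
    simp only [Polynomial.coeff_map, Polynomial.eval_add, Polynomial.eval_mul, Polynomial.eval_C,
      Polynomial.eval_pow, Polynomial.eval_X, mul_pow, hζ, one_mul]
    rw [← map_pow, ← map_mul, ← map_add, ← eval_eq, ht, map_zero]
  have hmem : ζ * φ t ∈ φ.fieldRange := h.splits.mem_range_of_isRoot h.ne_zero hroot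
  rw [← mul_div_cancel_right₀ ζ (map_ne_zero φ |>.2 ht₀)]
  exact div_mem hmem ⟨t, rfl⟩

theorem two_mul_le_of_real {P : ℝ[X]} (h : IsSylvesterPolynomial k n P) : 2 * k ≤ n := by
  obtain rfl | hk := Nat.eq_zero_or_pos k
  · omega
  by_contra! hn
  have coeff_eq_zero {m : ℕ} (hm : m ≤ k) (hkm : k ≤ m + 1) : P.coeff m = 0 :=
    h.hasCentralGap m hm (by omega)
  have hdeg : k - 1 < P.natDegree := by
    have := h.succ_le
    have := h.le_natDegree_add_one
    omega
  refine h.not_X_sq_dvd ((pow_dvd_pow _ (by omega)).trans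
    (X_pow_dvd_of_consecutive_coeff_eq_zero h.splits hdeg ?_ ?_))
  · exact coeff_eq_zero (Nat.sub_le _ _) (by omega)
  · exact coeff_eq_zero (by omega) (by omega)

end IsSylvesterPolynomial

theorem not_X_sq_dvd_nodal (T : Finset F) : ¬ Polynomial.X ^ 2 ∣ Lagrange.nodal T id := by
  have hsep : (Lagrange.nodal T id).Separable :=
    Polynomial.separable_prod_X_sub_C_iff'.2 Function.injective_id.injOn
  rw [sq]
  exact fun hdvd => Polynomial.not_isUnit_X (hsep.squarefree _ hdvd)

theorem isSylvesterPolynomial_nodal {T : Finset F} (hTn : T.card ≤ n) (hnT : n ≤ T.card + 1)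
    (h : HasCentralGap k n (Lagrange.nodal T id)) :
    IsSylvesterPolynomial k n (Lagrange.nodal T id) where
  splits := Polynomial.Splits.prod fun t _ => Polynomial.Splits.X_sub_C t
  not_X_sq_dvd := not_X_sq_dvd_nodal T
  natDegree_le := by rwa [Lagrange.natDegree_nodal]
  le_natDegree_add_one := by rwa [Lagrange.natDegree_nodal]
  hasCentralGap := h

theorem isSylvesterPolynomial_X_sub_one_mul_nodal {T : Finset F} (hTn : T.card ≤ n)
    (hnT : n ≤ T.card + 1)
    (h : HasCentralGap k (n + 1) ((Polynomial.X - Polynomial.C 1) * Lagrange.nodal T id)) :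
    IsSylvesterPolynomial k (n + 1)
      ((Polynomial.X - Polynomial.C 1) * Lagrange.nodal T id) := by
  have hdeg : ((Polynomial.X - Polynomial.C 1) * Lagrange.nodal T (id : F → F)).natDegree =
      T.card + 1 := by
    rw [(Polynomial.monic_X_sub_C 1).natDegree_mul Lagrange.nodal_monic,
      Polynomial.natDegree_X_sub_C, Lagrange.natDegree_nodal, add_comm]
  have hcoprime : IsCoprime (Polynomial.X ^ 2) (Polynomial.X - Polynomial.C (1 : F)) := by
    refine IsCoprime.pow_left ?_
    simpa using Polynomial.isCoprime_X_sub_C_of_isUnit_sub (a := (0 : F)) (b := 1) (by simp)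
  exact {
    splits := (Polynomial.Splits.X_sub_C 1).mul
      (Polynomial.Splits.prod fun t _ => Polynomial.Splits.X_sub_C t)
    not_X_sq_dvd := fun hdvd => not_X_sq_dvd_nodal T (hcoprime.dvd_of_dvd_mul_left hdvd)
    natDegree_le := by omega
    le_natDegree_add_one := by omega
    hasCentralGap := h }

end LowerBounds

section RealNodes

theorem neg_one_pow_mul_coeff_nodal_pos {R : Type*} [CommRing R] [LinearOrder R]
    [IsStrictOrderedRing R] {S : Finset R} (hS : ∀ s ∈ S, 0 < s) {m : ℕ} (hm : m ≤ S.card) :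
    0 < (-1) ^ (S.card + m) * (Lagrange.nodal S id).coeff m := by
  induction S using Finset.induction_on generalizing m with
  | empty => simp_all
  | insert s S hs ih =>
    have hs₀ : 0 < s := hS s (Finset.mem_insert_self s S)
    replace ih {m : ℕ} := @ih (fun t ht => hS t (Finset.mem_insert_of_mem ht)) m
    rw [Finset.card_insert_of_notMem hs] at hm ⊢
    rw [Lagrange.nodal_insert_eq_nodal hs, id, sub_mul, Polynomial.coeff_sub,
      Polynomial.coeff_C_mul]
    cases m with
    | zero =>
      rw [Polynomial.coeff_X_mul_zero]
      linear_combination mul_pos hs₀ (ih (Nat.zero_le _))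
    | succ m =>
      have hlower := ih (Nat.le_of_succ_le_succ hm)
      have hupper : 0 ≤ (-1) ^ (S.card + (m + 1)) * (Lagrange.nodal S id).coeff (m + 1) := by
        obtain hm' | hm' := le_or_gt (m + 1) S.card
        · exact (ih hm').le
        · rw [Polynomial.coeff_eq_zero_of_natDegree_lt (by rwa [Lagrange.natDegree_nodal]),
            mul_zero]
      rw [Polynomial.coeff_X_mul]
      linear_combination hlower + s * hupper

/-- If `q` is the nodal polynomial of `1, …, 2 k - 1`, then `q_{k - 1}` and `q_k` have opposite
signs, so that `(X - t) q` has no term in `X ^ k` for some `t < 0`. -/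
theorem exists_nodes_coeff_eq_zero {F : Type*} [Field F] [LinearOrder F]
    [IsStrictOrderedRing F] {k : ℕ} (hk : 1 ≤ k) :
    ∃ T : Finset F, 1 ∈ T ∧ T.card = 2 * k ∧ (Lagrange.nodal T id).coeff k = 0 := by
  obtain ⟨k, rfl⟩ := Nat.exists_eq_add_of_le' hk
  set S : Finset F := (Finset.Icc 1 (2 * k + 1)).map Nat.castEmbedding with hSdef
  have hS : ∀ s ∈ S, 0 < s := by
    simp only [hSdef, Finset.mem_map, Finset.mem_Icc, Nat.castEmbedding_apply]
    rintro _ ⟨i, hi, rfl⟩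
    exact_mod_cast hi.1
  have card_S : S.card = 2 * k + 1 := by simp [hSdef]
  set q := Lagrange.nodal S id
  have sign_k := neg_one_pow_mul_coeff_nodal_pos hS (m := k) (by omega)
  have sign_succ := neg_one_pow_mul_coeff_nodal_pos hS (m := k + 1) (by omega)
  set t : F := q.coeff k / q.coeff (k + 1)
  have hq : q.coeff (k + 1) ≠ 0 := right_ne_zero_of_mul sign_succ.ne'
  have ht : t < 0 := by
    have hsq : ((-1 : F) ^ (S.card + k)) ^ 2 = 1 := by rw [pow_right_comm, neg_one_sq, one_pow]
    refine div_neg_iff.2 (mul_neg_iff.1 ?_)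
    linear_combination mul_pos sign_k sign_succ - q.coeff k * q.coeff (k + 1) * hsq
  have htS : t ∉ S := fun h => (hS t h).not_gt ht
  refine ⟨insert t S, Finset.mem_insert_of_mem ?_, ?_, ?_⟩
  · exact Finset.mem_map.2 ⟨1, by simp, Nat.cast_one⟩
  · rw [Finset.card_insert_of_notMem htS, card_S]
    ring
  · rw [Lagrange.nodal_insert_eq_nodal htS, id, sub_mul, Polynomial.coeff_sub,
      Polynomial.coeff_X_mul, Polynomial.coeff_C_mul, div_mul_cancel₀ _ hq, sub_self]

end RealNodes

theorem nodal_nthRootsFinset {R : Type*} [CommRing R] [IsDomain R] {n : ℕ} (hn : 0 < n) {z : R}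
    (hz : IsPrimitiveRoot z n) :
    Lagrange.nodal (Polynomial.nthRootsFinset n 1) id = (Polynomial.X ^ n - 1 : R[X]) :=
  (Polynomial.X_pow_sub_one_eq_prod hn hz).symm

section Ranks

variable {K : Subfield ℂ} {k n : ℕ}

theorem isRelRank_of_nodes (hk : 1 ≤ k) {T : Finset K} (h1 : 1 ∈ T) (hTn : T.card ≤ n)
    (hnT : n ≤ T.card + 1) (hgap : HasCentralGap k n (Lagrange.nodal T id))
    (hmin : ∀ (N : ℕ) (P : K[X]), IsSylvesterPolynomial k N P → n ≤ N) :
    IsRelRank K (2 * k - 1) (oddForm k) (n - 1) ∧ IsRelRank K (2 * k) (evenForm k) n := by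
  classical
  have card_pos := Finset.card_pos.2 ⟨1, h1⟩
  have card_erase := Finset.card_erase_of_mem h1
  refine ⟨⟨(hasPowerRep_oddForm_iff hk).2
    ⟨T.erase 1, n - 1, by omega, by omega, le_rfl, ?_⟩, fun r hr => ?_⟩,
    ⟨hasPowerRep_evenForm_iff.2 ⟨T, n, hTn, hnT, le_rfl, hgap⟩, fun r hr => ?_⟩⟩
  · rwa [Nat.sub_add_cancel (card_pos.trans_le hTn), ← show Lagrange.nodal T id =
      (Polynomial.X - Polynomial.C 1) * _ from Lagrange.nodal_eq_mul_nodal_erase h1]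
  · obtain ⟨T', N, hT'N, hNT', hNr, hgap'⟩ := (hasPowerRep_oddForm_iff hk).1 hr
    have := hmin _ _ (isSylvesterPolynomial_X_sub_one_mul_nodal hT'N hNT' hgap')
    omega
  · obtain ⟨T', N, hT'N, hNT', hNr, hgap'⟩ := hasPowerRep_evenForm_iff.1 hr
    exact (hmin _ _ (isSylvesterPolynomial_nodal hT'N hNT' hgap')).trans hNr

theorem isRelRank_of_isPrimitiveRoot_succ (hk : 1 ≤ k) {z : K} (hz : IsPrimitiveRoot z (k + 1)) :
    IsRelRank K (2 * k - 1) (oddForm k) k ∧ IsRelRank K (2 * k) (evenForm k) (k + 1) := by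
  refine isRelRank_of_nodes hk (T := Polynomial.nthRootsFinset (k + 1) 1) ?_
    hz.card_nthRootsFinset.le (by rw [hz.card_nthRootsFinset]; omega) ?_ fun N P h => h.succ_le
  · exact Polynomial.one_mem_nthRootsFinset k.succ_pos
  · intro m hm hn
    rw [nodal_nthRootsFinset k.succ_pos hz, Polynomial.coeff_sub, Polynomial.coeff_X_pow,
      Polynomial.coeff_one, if_neg (by omega), if_neg (by omega), sub_zero]

theorem isRelRank_of_isPrimitiveRoot_of_notMem (hk : 1 ≤ k) {z : K} (hz : IsPrimitiveRoot z k)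
    {ζ : ℂ} (hζ : IsPrimitiveRoot ζ (k + 1)) (hζK : ζ ∉ K) :
    IsRelRank K (2 * k - 1) (oddForm k) (k + 1) ∧ IsRelRank K (2 * k) (evenForm k) (k + 2) := by
  classical
  set T : Finset K := Polynomial.nthRootsFinset k 1
  have h0 : 0 ∉ T := by
    rw [Polynomial.mem_nthRootsFinset hk, zero_pow (by omega)]
    exact zero_ne_one
  have card_insert : (insert 0 T).card = k + 1 := by
    rw [Finset.card_insert_of_notMem h0, hz.card_nthRootsFinset]
  refine isRelRank_of_nodes hk (T := insert 0 T) (n := k + 2) ?_ (by omega) (by omega) ?_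
    fun N P h => ?_
  · exact Finset.mem_insert_of_mem (Polynomial.one_mem_nthRootsFinset hk)
  · intro m hm hn
    obtain ⟨m, rfl⟩ := Nat.exists_eq_add_of_le' (by omega : 1 ≤ m)
    rw [Lagrange.nodal_insert_eq_nodal h0, nodal_nthRootsFinset hk hz, id, Polynomial.C_0, sub_zero,
      Polynomial.coeff_X_mul, Polynomial.coeff_sub, Polynomial.coeff_X_pow, Polynomial.coeff_one,
      if_neg (by omega), if_neg (by omega), sub_zero]
  · refine Nat.succ_le_of_lt (h.succ_le.lt_of_ne ?_)
    rintro rfl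
    obtain ⟨x, rfl⟩ := h.mem_fieldRange hk K.subtype hζ.pow_eq_one
    exact hζK x.2

theorem isRelRank_of_real (hk : 1 ≤ k) (φ : K →+* ℝ) :
    IsRelRank K (2 * k - 1) (oddForm k) (2 * k - 1) ∧
      IsRelRank K (2 * k) (evenForm k) (2 * k) := by
  obtain ⟨S, h1, card_S, hcoeff⟩ := exists_nodes_coeff_eq_zero (F := ℚ) hk
  set T : Finset K := S.map ⟨Rat.castHom K, (Rat.castHom K).injective⟩ with hT
  have hnodal : Lagrange.nodal T id = (Lagrange.nodal S id).map (Rat.castHom K) := by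
    simp [Lagrange.nodal, hT, Polynomial.map_prod]
  have card_T : T.card = 2 * k := by rw [hT, Finset.card_map, card_S]
  refine isRelRank_of_nodes hk (T := T) ?_ card_T.le (by omega) ?_
    fun N P h => (h.map φ).two_mul_le_of_real
  · exact Finset.mem_map.2 ⟨1, h1, Rat.cast_one⟩
  · intro m hm hn
    rw [hnodal, Polynomial.coeff_map, show m = k by omega, hcoeff, map_zero]

theorem isPrimitiveRoot_adjoinSimple_gen (F : Type*) {E : Type*} [Field F] [Field E] [Algebra F E]
    {ζ : E} {n : ℕ} (hζ : IsPrimitiveRoot ζ n) :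
    IsPrimitiveRoot (IntermediateField.AdjoinSimple.gen F ζ) n :=
  hζ.of_map_of_injective (f := algebraMap F⟮ζ⟯ E) Subtype.val_injective

theorem notMem_adjoin_of_isPrimitiveRoot {k : ℕ} (hk : 2 ≤ k) {ζ ξ : ℂ}
    (hζ : IsPrimitiveRoot ζ (k + 1)) (hξ : IsPrimitiveRoot ξ k) : ζ ∉ ℚ⟮ξ⟯ := by
  intro hmem
  have : NeZero k := ⟨by omega⟩
  have : IsCyclotomicExtension {k} ℚ ℚ⟮ξ⟯ :=
    (IntermediateField.isCyclotomicExtension_singleton_iff_eq_adjoin k ℚ ℂ ℚ⟮ξ⟯ hξ).2 rfl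
  have : NumberField ℚ⟮ξ⟯ := IsCyclotomicExtension.numberField {k} ℚ _
  have hζ' : IsPrimitiveRoot (⟨ζ, hmem⟩ : ℚ⟮ξ⟯) (k + 1) :=
    IsPrimitiveRoot.of_map_of_injective (f := algebraMap ℚ⟮ξ⟯ ℂ) hζ Subtype.val_injective
  have hdvd : k + 1 ∣ 2 * k := hζ'.dvd_of_isCyclotomicExtension k k.succ_ne_zero
  have hdvd_two : k + 1 ∣ 2 := (Nat.coprime_self_add_left.2 (by simp)).dvd_of_dvd_mul_right hdvd
  have := Nat.le_of_dvd two_pos hdvd_two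
  omega

end Ranks

theorem theorem3p1 :
    (∀ d : ℕ, 5 ≤ d → ∃ p : MvPolynomial (Fin 2) ℂ,
      p.IsHomogeneous d ∧ 3 ≤ (relRanks d p).encard) ∧
    (∀ k : ℕ, 3 ≤ k → ∀ ζ ξ : ℂ, IsPrimitiveRoot ζ (k + 1) → IsPrimitiveRoot ξ k →
      (IsRelRank ℚ⟮ζ⟯.toSubfield (2 * k - 1) (oddForm k) k ∧
        IsRelRank ℚ⟮ξ⟯.toSubfield (2 * k - 1) (oddForm k) (k + 1) ∧
        IsRelRank realSubfield (2 * k - 1) (oddForm k) (2 * k - 1)) ∧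
      (IsRelRank ℚ⟮ζ⟯.toSubfield (2 * k) (evenForm k) (k + 1) ∧
        IsRelRank ℚ⟮ξ⟯.toSubfield (2 * k) (evenForm k) (k + 2) ∧
        IsRelRank realSubfield (2 * k) (evenForm k) (2 * k))) := by
  refine (and_iff_right_of_imp fun explicit d hd => ?_).2 fun k hk ζ ξ hζ hξ => ?_
  · obtain ⟨k, rfl | rfl⟩ : ∃ k, d = 2 * k - 1 ∨ d = 2 * k := ⟨(d + 1) / 2, by omega⟩
    all_goals
      obtain ⟨⟨o₁, o₂, o₃⟩, e₁, e₂, e₃⟩ := explicit k (by omega) _ _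
        (Complex.isPrimitiveRoot_exp (k + 1) (by omega)) (Complex.isPrimitiveRoot_exp k (by omega))
    · exact ⟨_, o₁.1.isHomogeneous, three_le_encard_relRanks o₁ o₂ o₃ (by omega) (by omega)⟩
    · exact ⟨_, e₁.1.isHomogeneous, three_le_encard_relRanks e₁ e₂ e₃ (by omega) (by omega)⟩
  · have hk₁ : 1 ≤ k := by omega
    have rank₁ := isRelRank_of_isPrimitiveRoot_succ (K := ℚ⟮ζ⟯.toSubfield) hk₁
      (isPrimitiveRoot_adjoinSimple_gen ℚ hζ)
    have rank₂ := isRelRank_of_isPrimitiveRoot_of_notMem (K := ℚ⟮ξ⟯.toSubfield) hk₁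
      (isPrimitiveRoot_adjoinSimple_gen ℚ hξ) hζ
      (notMem_adjoin_of_isPrimitiveRoot (by omega) hζ hξ)
    have rank₃ := isRelRank_of_real (K := realSubfield) hk₁
      (RingEquiv.ofLeftInverse (f := Complex.ofRealHom) Complex.ofReal_re).symm.toRingHom
    exact ⟨⟨rank₁.1, rank₂.1, rank₃.1⟩, rank₁.2, rank₂.2, rank₃.2⟩
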